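/- Let $\mathbb{T}\subseteq\mathbb{R}_+^d\times\mathbb{R}_+$ be a technology satisfying free disposability: if $(x,y)\in\mathbb{T}$, $x'\ge x$ componentwise and $0\le y'\le y$, then $(x',y')\in\mathbb{T}$. Let $(X_i,Y_i)_{i\ge 1}$ be i.i.d. random pairs with $(X_i,Y_i)\in\mathbb{T}$ almost surely. Fix $x\in\mathbb{R}^d$ with $p_0:=P(X_1\le x)>0$, and let $F(y)=P(Y_1\le y\mid X_1\le x)$ and $q(\tau)=\inf\{y\in\mathbb{R}: F(y)\ge\tau\}$. Let $k>0$ be a real number such that $kp_0$ is not an integer, and put $\tau_n=1-k/n$. Assume that $F$ belongs to the domain of attraction of type III (Weibull) extreme value distributions with index $\xi_0<0$, i.e. its upper endpoint $z_1=\sup\{z:F(z)<1\}$ is finite and, for every $v>0$, $$\frac{1-F(z_1-vz)}{1-F(z_1-z)}\longrightarrow v^{-1/\xi_0}\qquad\text{as } z\downarrow 0 .$$ For $n>k$ let $\hat q_n(\tau_n)$ be any (measurable) minimizer $$\hat q_n(\tau_n)\in\operatorname*{arg\,min}_{q\in\mathbb{R}}\ \sum_{i=1}^n\rho_{\tau_n}(Y_i-q)\,\mathbf{1}\{X_i\le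 x\},\qquad \rho_\tau(u)=(\tau-\mathbf{1}\{u\le 0\})\,u .$$ Let $\alpha_n=1/\bigl(q(1)-q(1-1/n)\bigr)$ and $\eta(t)=t^{-\xi_0}$, and let $\mathcal{E}_1,\mathcal{E}_2,\dots$ be i.i.d. standard exponential random variables. Then there is exactly one integer $h\in[kp_0,kp_0+1]$ and, with $\mathcal{J}_h=\eta\bigl(\sum_{l=1}^h\mathcal{E}_l/p_0\bigr)=\bigl(\sum_{l=1}^h\mathcal{E}_l/p_0\bigr)^{-\xi_0}$, as $n\to\infty$, $$\alpha_n\bigl(\hat q_n(\tau_n)-q(1)\bigr)\ \xrightarrow{d}\ -\mathcal{J}_h \qquad\text{and}\qquad \alpha_n\bigl(\hat q_n(\tau_n)-q(\tau_n)\bigr)\ \xrightarrow{d}\ -\mathcal{J}_h+\eta(k).$$ -/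

import Mathlib

open MeasureTheory ProbabilityTheory Filter Topology

noncomputable section

namespace Frontier

/-- A technology with `d` nonnegative inputs and one nonnegative output: a set of feasible pairs
`(x, y)` with `x ∈ ℝ₊ᵈ` and `y ∈ ℝ₊`. -/
def IsTechnology {d : ℕ} (T : Set ((Fin d → ℝ) × ℝ)) : Prop :=
  ∀ z ∈ T, 0 ≤ z.1 ∧ 0 ≤ z.2

/-- Free disposability: more input (componentwise) can always produce less (nonnegative) output. -/
def FreeDisposability {d : ℕ} (T : Set ((Fin d → ℝ) × ℝ)) : Prop :=
  ∀ x y, (x, y) ∈ T → ∀ x' y', x ≤ x' → 0 ≤ y' → y' ≤ y → (x', y') ∈ T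

/-- The nonstandard conditional distribution function `F(y / x) = P(Y ≤ y | X ≤ x)`. -/
def condCDF {Ω : Type*} [MeasurableSpace Ω] (P : Measure Ω) {d : ℕ}
    (X : Ω → Fin d → ℝ) (Y : Ω → ℝ) (x : Fin d → ℝ) (y : ℝ) : ℝ :=
  (P[|{ω | X ω ≤ x}]).real {ω | Y ω ≤ y}

/-- The quantile function `F⁻¹(τ) = inf {y | F y ≥ τ}`. -/
def quantile (F : ℝ → ℝ) (τ : ℝ) : ℝ :=
  sInf {y | τ ≤ F y}

/-- The upper endpoint `sup {z | F z < 1}`. -/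
def upperEndpoint (F : ℝ → ℝ) : ℝ :=
  sSup {z | F z < 1}

/-- `F` belongs to the domain of attraction of type III (Weibull) extreme value distributions with
extreme value index `ξ`: `ξ < 0`, the upper endpoint `z₁` is finite, and
`(1 - F (z₁ - v z)) / (1 - F (z₁ - z)) → v ^ (-1/ξ)` as `z ↓ 0`, for every `v > 0`. -/
def InTypeIIIDomain (F : ℝ → ℝ) (ξ : ℝ) : Prop :=
  ξ < 0 ∧ BddAbove {z | F z < 1} ∧
    ∀ v : ℝ, 0 < v →
      Tendsto (fun z : ℝ => (1 - F (upperEndpoint F - v * z)) / (1 - F (upperEndpoint F - z)))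
        (𝓝[>] 0) (𝓝 (v ^ (-1 / ξ)))

/-- The check function `ρ_τ(u) = (τ - 1{u ≤ 0}) u`. -/
def checkFn (τ u : ℝ) : ℝ :=
  (τ - (Set.Iic (0 : ℝ)).indicator 1 u) * u

/-- The objective `q ↦ ∑_{i < n} ρ_τ(Y_i - q) 1{X_i ≤ x}` at a realization `(X_i, Y_i)` of the
data. -/
def objective {d : ℕ} (X : ℕ → Fin d → ℝ) (Y : ℕ → ℝ) (x : Fin d → ℝ) (n : ℕ) (τ q : ℝ) : ℝ :=
  ∑ i ∈ Finset.range n, checkFn τ (Y i - q) * (Set.Iic x).indicator 1 (X i)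

/-- `q` belongs to the set of minimizers over `ℝ` of the objective. -/
def IsSampleQuantile {d : ℕ} (X : ℕ → Fin d → ℝ) (Y : ℕ → ℝ) (x : Fin d → ℝ) (n : ℕ)
    (τ q : ℝ) : Prop :=
  ∀ q' : ℝ, objective X Y x n τ q ≤ objective X Y x n τ q'

/-- The normalizing sequence `α_n = 1 / (F⁻¹(1) - F⁻¹(1 - 1/n))`. -/
def normRate (F : ℝ → ℝ) (n : ℕ) : ℝ :=
  1 / (quantile F 1 - quantile F (1 - 1 / (n : ℝ)))

/-- `η(t) = t ^ (-ξ)`. -/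
def eta (ξ t : ℝ) : ℝ := t ^ (-ξ)

/-- `J_h = η((E_1 + ⋯ + E_h) / p₀)`, with `E_1, E_2, …` stored as `E 0, E 1, …`. -/
def limitVar {Ω' : Type*} (E : ℕ → Ω' → ℝ) (p₀ ξ : ℝ) (h : ℕ) (ω : Ω') : ℝ :=
  eta ξ ((∑ l ∈ Finset.range h, E l ω) / p₀)

end Frontier

end

namespace Frontier

/-! The argument turns a statement about a minimizer into one about a count. Let N be the number of
observations with input at most x. The check-function objective is convex and piecewise linear, and
the sign of its one-sided slopes compares (1 - τ)N with the number of dominated outputs above a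
threshold. When (1 - τ)N lies strictly between m and m + 1, the minimizer is at most t exactly when
at most m of those outputs exceed t (`IsSampleQuantile.le_iff`). Here (1 - τ_n)N = kN/n tends to k
p₀, which is not an integer, so with m = ⌊k p₀⌋ this holds with probability tending to 1
(`tendsto_measureReal_dominatedCount_notMem`).

The count above q(1) + s/α_n is binomial. The domain-of-attraction condition makes its mean converge
to p₀ max(-s, 0)^(-1/ξ) (`tendsto_mul_endpointTail_max`), so the count has a Poisson limit. A
Poisson variable of mean r is at most m with the same probability that m + 1 standard exponentials
sum to at least r (`measure_le_sum_exponential`), and this is where h = m + 1 and the limit variable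
come from.

Changing the centring from q(1) to q(τ_n) adds a deterministic term converging to η(k)
(`tendsto_quantileGap_div`), so Slutsky's lemma gives the second limit. -/

/-! ### Binomial counts -/

/-- The number of successes among the first `n` terms of an i.i.d. Bernoulli sequence has a binomial
distribution. -/
theorem measureReal_sum_bernoulli_eq {Ω : Type*} [MeasurableSpace Ω] {P : Measure Ω}
    [IsProbabilityMeasure P] {W : ℕ → Ω → ℕ} (hW : ∀ i, Measurable (W i))
    (hle : ∀ i ω, W i ω ≤ 1) (hindep : iIndepFun W P) {p : ℝ}
    (hp : ∀ i, P.real {ω | W i ω = 1} = p) (n j : ℕ) :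
    P.real {ω | ∑ i ∈ Finset.range n, W i ω = j} = n.choose j * p ^ j * (1 - p) ^ (n - j) := by
  induction n generalizing j with
  | zero => cases j <;> simp
  | succ n ih =>
    have hS : Measurable fun ω => ∑ i ∈ Finset.range n, W i ω :=
      Finset.measurable_fun_sum _ fun i _ => hW i
    have hq : P.real {ω | W n ω = 0} = 1 - p := by
      rw [← hp n, ← probReal_compl_eq_one_sub (measurableSet_eq_fun (hW n) measurable_const)]
      congr 1
      ext ω
      have := hle n ω
      simp only [Set.mem_ofPred_eq, Set.mem_compl_iff]
      omega
    have hI : IndepFun (fun ω => ∑ i ∈ Finset.range n, W i ω) (W n) P := by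
      have := hindep.indepFun_finsetSum_of_notMem hW (s := Finset.range n) (i := n) (by simp)
      convert this using 1
      ext ω
      simp
    have hmul (a b : ℕ) : P.real {ω | ∑ i ∈ Finset.range n, W i ω = a ∧ W n ω = b} =
        P.real {ω | ∑ i ∈ Finset.range n, W i ω = a} * P.real {ω | W n ω = b} := by
      have := hI.measure_inter_preimage_eq_mul {a} {b} (measurableSet_singleton _)
        (measurableSet_singleton _)
      rw [measureReal_def, measureReal_def, measureReal_def, ← ENNReal.toReal_mul]
      exact congrArg ENNReal.toReal this
    cases j with
    | zero =>
      have : {ω | ∑ i ∈ Finset.range (n + 1), W i ω = 0} =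
          {ω | ∑ i ∈ Finset.range n, W i ω = 0 ∧ W n ω = 0} := by
        ext ω
        simp only [Finset.sum_range_succ, Set.mem_ofPred_eq]
        omega
      rw [this, hmul, ih, hq]
      simp [pow_succ]
    | succ j =>
      have : {ω | ∑ i ∈ Finset.range (n + 1), W i ω = j + 1} =
          {ω | ∑ i ∈ Finset.range n, W i ω = j ∧ W n ω = 1} ∪
          {ω | ∑ i ∈ Finset.range n, W i ω = j + 1 ∧ W n ω = 0} := by
        ext ω
        have := hle n ω
        simp only [Finset.sum_range_succ, Set.mem_ofPred_eq, Set.mem_union]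
        omega
      rw [this, measureReal_union, hmul, hmul, ih, ih, hq, hp, Nat.choose_succ_succ,
        Nat.add_sub_add_right]
      · rcases le_or_gt (j + 1) n with h | h
        · have : n - j = n - (j + 1) + 1 := by omega
          rw [this]
          push_cast
          ring
        · rw [Nat.choose_eq_zero_of_lt h]
          push_cast
          ring
      · rw [Set.disjoint_left]
        rintro ω ⟨h1, -⟩ ⟨h2, -⟩
        omega
      · exact (measurableSet_eq_fun hS measurable_const).inter
          (measurableSet_eq_fun (hW n) measurable_const)

/-! ### Poisson probabilities and sums of exponentials -/

/-- The probability that a Poisson variable of mean `r` is at most `m`. -/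
noncomputable def poissonCDF (m : ℕ) (r : ℝ) : ℝ :=
  ∑ j ∈ Finset.range (m + 1), Real.exp (-r) * r ^ j / j.factorial

theorem poissonCDF_nonneg (m : ℕ) {r : ℝ} (hr : 0 ≤ r) : 0 ≤ poissonCDF m r :=
  Finset.sum_nonneg fun _ _ => by positivity

theorem poissonCDF_zero_right (m : ℕ) : poissonCDF m 0 = 1 := by
  simp [poissonCDF, Finset.sum_range_succ']

/-- This is the recursion obtained by conditioning on one exponential variable u: the integral
covers u ≤ r, and `Real.exp (-r)` is the probability that u alone exceeds r. Integrating the term of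
degree j produces the term of degree j + 1, so the extra exponential supplies the missing term of
degree 0. -/
theorem integral_exp_neg_mul_poissonCDF (m : ℕ) (r : ℝ) :
    (∫ u in (0 : ℝ)..r, Real.exp (-u) * poissonCDF m (r - u)) + Real.exp (-r) =
      poissonCDF (m + 1) r := by
  have h1 : ∀ u : ℝ, Real.exp (-u) * poissonCDF m (r - u) =
      ∑ j ∈ Finset.range (m + 1), Real.exp (-r) / j.factorial * (r - u) ^ j := by
    intro u
    rw [poissonCDF, Finset.mul_sum]
    refine Finset.sum_congr rfl fun j _ => ?_
    have : Real.exp (-r) = Real.exp (-u) * Real.exp (-(r - u)) := by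
      rw [← Real.exp_add]
      ring_nf
    rw [this]
    ring
  simp_rw [h1]
  rw [intervalIntegral.integral_finsetSum]
  · rw [poissonCDF, Finset.sum_range_succ' _ (m + 1)]
    simp only [pow_zero, Nat.factorial_zero, Nat.cast_one, mul_one, div_one, add_left_inj]
    refine Finset.sum_congr rfl fun j _ => ?_
    rw [intervalIntegral.integral_const_mul,
      intervalIntegral.integral_comp_sub_left (fun u => u ^ j) r]
    simp only [sub_self, sub_zero, integral_pow, Nat.factorial_succ]
    push_cast
    have : (0 : ℝ) < j.factorial := by positivity
    field_simp
    simp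
  · intro j _
    exact Continuous.intervalIntegrable (by fun_prop) _ _

instance : IsProbabilityMeasure (expMeasure 1) := isProbabilityMeasure_expMeasure one_pos

instance : NullSingletonClass (expMeasure 1) where
  measure_singleton u := withDensity_absolutelyContinuous _ _ (measure_singleton u)

theorem expMeasure_one_Ici (r : ℝ) :
    expMeasure 1 (Set.Ici r) = ENNReal.ofReal (Real.exp (-max r 0)) := by
  have h1 := cdf_expMeasure_eq one_pos r
  rw [cdf_eq_real, one_mul] at h1
  rw [← measure_congr (Ioi_ae_eq_Ici (a := r)), ← Set.compl_Iic, ← ofReal_measureReal,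
    probReal_compl_eq_one_sub measurableSet_Iic, h1]
  rcases le_or_gt 0 r with hr | hr
  · rw [if_pos hr, max_eq_left hr]
    ring_nf
  · rw [if_neg hr.not_ge, max_eq_right hr.le]
    simp

/-- The truncation at 0 makes the integrand 1 once u passes r, so the half-line above r contributes
`Real.exp (-r)`; the negative half-line is null, and the rest is the preceding recursion. -/
theorem lintegral_expMeasure_poissonCDF (m : ℕ) {r : ℝ} (hr : 0 < r) :
    ∫⁻ u, ENNReal.ofReal (poissonCDF m (max (r - u) 0)) ∂(expMeasure 1) =
      ENNReal.ofReal (poissonCDF (m + 1) r) := by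
  have hcont : Continuous fun u : ℝ => Real.exp (-u) * poissonCDF m (r - u) := by
    unfold poissonCDF
    fun_prop
  have hmeas : Measurable fun u : ℝ => ENNReal.ofReal (poissonCDF m (max (r - u) 0)) := by
    unfold poissonCDF
    fun_prop
  rw [← lintegral_add_compl _ (measurableSet_Ioi (a := r)), Set.compl_Ioi,
    ← Set.Iic_union_Ioc_eq_Iic hr.le,
    lintegral_union measurableSet_Ioc (Set.Iic_disjoint_Ioc le_rfl)]
  have h1 : ∫⁻ u in Set.Ioi r, ENNReal.ofReal (poissonCDF m (max (r - u) 0)) ∂(expMeasure 1) =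
      ENNReal.ofReal (Real.exp (-r)) := by
    rw [setLIntegral_congr_fun (g := fun _ => 1) measurableSet_Ioi]
    · rw [setLIntegral_one, measure_congr (Ioi_ae_eq_Ici (a := r)), expMeasure_one_Ici,
        max_eq_left hr.le]
    · intro u hu
      have : r - u ≤ 0 := sub_nonpos.2 (le_of_lt hu)
      simp [max_eq_right this, poissonCDF_zero_right]
  have h2 : ∫⁻ u in Set.Iic 0, ENNReal.ofReal (poissonCDF m (max (r - u) 0)) ∂(expMeasure 1) =
      0 := by
    refine setLIntegral_measure_zero _ _ ?_
    rw [← measure_congr (Iio_ae_eq_Iic (a := (0 : ℝ))), ← Set.compl_Ici,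
      prob_compl_eq_zero_iff measurableSet_Ici, expMeasure_one_Ici]
    simp
  have h3 : ∫⁻ u in Set.Ioc 0 r, ENNReal.ofReal (poissonCDF m (max (r - u) 0)) ∂(expMeasure 1) =
      ENNReal.ofReal (∫ u in (0 : ℝ)..r, Real.exp (-u) * poissonCDF m (r - u)) := by
    rw [intervalIntegral.integral_of_le hr.le, ofReal_integral_eq_lintegral_ofReal
      hcont.integrableOn_Ioc ?_]
    · have h0 : expMeasure 1 = volume.withDensity (exponentialPDF 1) := rfl
      rw [h0, setLIntegral_withDensity_eq_setLIntegral_mul _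
        (f := exponentialPDF 1) (measurable_exponentialPDFReal 1).ennreal_ofReal hmeas
        measurableSet_Ioc]
      refine setLIntegral_congr_fun measurableSet_Ioc fun u hu => ?_
      have h4 := exponentialPDF_of_nonneg (r := 1) hu.1.le
      simp only [Pi.mul_apply]
      rw [h4, max_eq_left (sub_nonneg.2 hu.2), ← ENNReal.ofReal_mul (by positivity)]
      simp
    · filter_upwards [ae_restrict_mem measurableSet_Ioc] with u hu
      exact mul_nonneg (Real.exp_nonneg _) (poissonCDF_nonneg m (sub_nonneg.2 hu.2))
  rw [h1, h2, h3, zero_add, ← ENNReal.ofReal_add (Real.exp_nonneg _), add_comm,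
    integral_exp_neg_mul_poissonCDF]
  exact intervalIntegral.integral_nonneg hr.le fun u hu =>
    mul_nonneg (Real.exp_nonneg _) (poissonCDF_nonneg m (sub_nonneg.2 hu.2))

theorem ae_nonneg_of_hasLaw_exponential {Ω : Type*} [MeasurableSpace Ω] {P : Measure Ω}
    {E : ℕ → Ω → ℝ} (hlaw : ∀ l, HasLaw (E l) (expMeasure 1) P) : ∀ᵐ ω ∂P, ∀ l, 0 ≤ E l ω := by
  rw [ae_all_iff]
  intro l
  rw [(hlaw l).ae_iff (p := fun u => 0 ≤ u) (by measurability)]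
  have : expMeasure 1 (Set.Ici 0) = 1 := by simp [expMeasure_one_Ici]
  exact (prob_compl_eq_zero_iff measurableSet_Ici).2 this

/-- The survival function of a sum of `m + 1` i.i.d. standard exponential variables. -/
theorem measure_le_sum_exponential {Ω : Type*} [MeasurableSpace Ω] {P : Measure Ω}
    [IsProbabilityMeasure P] {E : ℕ → Ω → ℝ} (hindep : iIndepFun E P)
    (hlaw : ∀ l, HasLaw (E l) (expMeasure 1) P) (m : ℕ) (r : ℝ) :
    P {ω | r ≤ ∑ l ∈ Finset.range (m + 1), E l ω} = ENNReal.ofReal (poissonCDF m (max r 0)) := by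
  induction m generalizing r with
  | zero =>
    have : {ω | r ≤ ∑ l ∈ Finset.range (0 + 1), E l ω} = E 0 ⁻¹' Set.Ici r := by
      ext ω
      simp
    rw [this, ← Measure.map_apply_of_aemeasurable (hlaw 0).aemeasurable measurableSet_Ici,
      (hlaw 0).map_eq, expMeasure_one_Ici]
    simp [poissonCDF]
  | succ m ih =>
    rcases le_or_gt r 0 with hr | hr
    · rw [max_eq_right hr, poissonCDF_zero_right, ENNReal.ofReal_one]
      refine (measure_eq_measure_of_null_sdiff (Set.subset_univ _) ?_).trans measure_univ
      refine measure_mono_null ?_ (ae_nonneg_of_hasLaw_exponential hlaw)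
      intro ω hω h
      exact hω.2 (hr.trans (Finset.sum_nonneg fun l _ => h l))
    · have hA : AEMeasurable (fun ω => ∑ l ∈ Finset.range (m + 1), E l ω) P :=
        Finset.aemeasurable_fun_sum _ fun l _ => (hlaw l).aemeasurable
      have hB := (hlaw (m + 1)).aemeasurable
      have hI : IndepFun (fun ω => ∑ l ∈ Finset.range (m + 1), E l ω) (E (m + 1)) P := by
        have := hindep.indepFun_finsetSum_of_notMem₀ (fun l => (hlaw l).aemeasurable)
          (s := Finset.range (m + 1)) (i := m + 1) (by simp)
        convert this using 1
        ext ω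
        simp
      have hT : MeasurableSet {z : ℝ × ℝ | r ≤ z.1 + z.2} :=
        measurableSet_le measurable_const (by fun_prop)
      have h1 : {ω | r ≤ ∑ l ∈ Finset.range (m + 1 + 1), E l ω} =
          (fun ω => (∑ l ∈ Finset.range (m + 1), E l ω, E (m + 1) ω)) ⁻¹'
            {z : ℝ × ℝ | r ≤ z.1 + z.2} := by
        ext ω
        simp [Finset.sum_range_succ]
      have : IsProbabilityMeasure (P.map fun ω => ∑ l ∈ Finset.range (m + 1), E l ω) :=
        Measure.isProbabilityMeasure_map hA
      rw [h1, ← Measure.map_apply_of_aemeasurable (hA.prodMk hB) hT,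
        (indepFun_iff_map_prod_eq_prod_map_map hA hB).1 hI, (hlaw (m + 1)).map_eq,
        Measure.prod_apply_symm hT, max_eq_left hr.le, ← lintegral_expMeasure_poissonCDF m hr]
      refine lintegral_congr fun u => ?_
      rw [← ih, Measure.map_apply_of_aemeasurable hA]
      · congr 1
        ext ω
        simp
      · exact measurable_prodMk_right hT

/-! ### Quantiles near a Weibull-type endpoint -/

section Quantile

/-- Right-continuity of the distribution function makes the infimum attained. The two hypotheses
make the set bounded below and nonempty, so that `sInf` does not take its default value. -/
theorem quantile_le_iff {μ : Measure ℝ} {τ : ℝ} (hτ : 0 < τ) (hne : ∃ y, τ ≤ cdf μ y) {y : ℝ} :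
    quantile (cdf μ) τ ≤ y ↔ τ ≤ cdf μ y := by
  have hbdd : BddBelow {y | τ ≤ cdf μ y} := by
    obtain ⟨a, ha⟩ := ((tendsto_cdf_atBot μ).eventually_lt_const hτ).exists
    refine ⟨a, fun z hz => ?_⟩
    by_contra! h
    exact (hz.trans (monotone_cdf μ h.le)).not_gt ha
  refine ⟨fun h => ?_, fun h => csInf_le hbdd h⟩
  refine ge_of_tendsto (((cdf μ).right_continuous y).tendsto.mono_left
    (nhdsWithin_mono y Set.Ioi_subset_Ici_self)) ?_
  filter_upwards [self_mem_nhdsWithin] with z hz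
  obtain ⟨w, hw, hwz⟩ := exists_lt_of_csInf_lt hne (h.trans_lt hz)
  exact le_trans hw (monotone_cdf μ hwz.le)

variable {μ : Measure ℝ} {ξ : ℝ}

theorem cdf_lt_one_of_lt_upperEndpoint {y : ℝ} (hy : y < upperEndpoint (cdf μ)) :
    cdf μ y < 1 := by
  have hne : {z | cdf μ z < 1}.Nonempty :=
    ((tendsto_cdf_atBot μ).eventually_lt_const one_pos).exists
  obtain ⟨w, hw, hyw⟩ := exists_lt_of_lt_csSup hne hy
  exact (monotone_cdf μ hyw.le).trans_lt hw

theorem cdf_eq_one_of_upperEndpoint_lt (hb : BddAbove {z | cdf μ z < 1}) {y : ℝ}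
    (hy : upperEndpoint (cdf μ) < y) : cdf μ y = 1 := by
  by_contra h
  exact (le_csSup hb (lt_of_le_of_ne (cdf_le_one μ y) h)).not_gt hy

theorem quantile_one_eq_upperEndpoint (hb : BddAbove {z | cdf μ z < 1}) :
    quantile (cdf μ) 1 = upperEndpoint (cdf μ) := by
  have hne : ∃ y, 1 ≤ cdf μ y := ⟨_, (cdf_eq_one_of_upperEndpoint_lt hb (lt_add_one _)).ge⟩
  refine le_antisymm (le_of_forall_gt_imp_ge_of_dense fun y hy => ?_) ?_
  · rw [quantile_le_iff one_pos hne, cdf_eq_one_of_upperEndpoint_lt hb hy]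
  · by_contra! h
    exact (cdf_lt_one_of_lt_upperEndpoint h).not_ge ((quantile_le_iff one_pos hne).1 le_rfl)

theorem cdf_upperEndpoint (hb : BddAbove {z | cdf μ z < 1}) :
    cdf μ (upperEndpoint (cdf μ)) = 1 := by
  have hne : ∃ y, 1 ≤ cdf μ y := ⟨_, (cdf_eq_one_of_upperEndpoint_lt hb (lt_add_one _)).ge⟩
  refine le_antisymm (cdf_le_one _ _) ?_
  rw [← quantile_le_iff one_pos hne, quantile_one_eq_upperEndpoint hb]

/-- The mass that `μ` puts strictly above the point at distance `z` below its upper endpoint. -/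
noncomputable def endpointTail (μ : Measure ℝ) (z : ℝ) : ℝ :=
  1 - cdf μ (upperEndpoint (cdf μ) - z)

theorem endpointTail_pos {z : ℝ} (hz : 0 < z) : 0 < endpointTail μ z :=
  sub_pos.2 (cdf_lt_one_of_lt_upperEndpoint (by linarith))

theorem endpointTail_nonneg (z : ℝ) : 0 ≤ endpointTail μ z := sub_nonneg.2 (cdf_le_one _ _)

theorem endpointTail_mono : Monotone (endpointTail μ) := fun a b hab =>
  sub_le_sub_left (monotone_cdf μ (by linarith)) 1

theorem endpointTail_of_nonpos (hb : BddAbove {z | cdf μ z < 1}) {z : ℝ} (hz : z ≤ 0) :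
    endpointTail μ z = 0 := by
  refine le_antisymm ?_ (endpointTail_nonneg z)
  refine (endpointTail_mono hz).trans_eq ?_
  simp [endpointTail, cdf_upperEndpoint hb]

theorem tendsto_endpointTail_div (h : InTypeIIIDomain (cdf μ) ξ) {v : ℝ} (hv : 0 < v) :
    Tendsto (fun z => endpointTail μ (v * z) / endpointTail μ z) (𝓝[>] 0) (𝓝 (v ^ (-1 / ξ))) :=
  h.2.2 v hv

theorem neg_one_div_pos (h : InTypeIIIDomain (cdf μ) ξ) : 0 < -1 / ξ :=
  div_pos_of_neg_of_neg (by norm_num) h.1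

/-- There is no atom at the endpoint: with a nonzero limit, the tail ratio for v = 1/2 would tend to
1, whereas (1/2)^(-1/ξ) < 1. -/
theorem tendsto_endpointTail_zero (h : InTypeIIIDomain (cdf μ) ξ) :
    Tendsto (endpointTail μ) (𝓝[>] 0) (𝓝 0) := by
  obtain ⟨l, hl⟩ : ∃ l, Tendsto (endpointTail μ) (𝓝[>] 0) (𝓝 l) :=
    ⟨_, endpointTail_mono.tendsto_nhdsGT 0⟩
  rcases eq_or_ne l 0 with rfl | hl0
  · exact hl
  have hhalf : Tendsto (fun z : ℝ => (1 / 2) * z) (𝓝[>] 0) (𝓝[>] 0) := by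
    refine tendsto_nhdsWithin_iff.2 ⟨?_, ?_⟩
    · have : Tendsto (fun z : ℝ => (1 / 2) * z) (𝓝 0) (𝓝 (1 / 2 * 0)) := by
        exact (continuous_const.mul continuous_id).tendsto 0
      rw [mul_zero] at this
      exact this.mono_left nhdsWithin_le_nhds
    · filter_upwards [self_mem_nhdsWithin] with z hz
      exact mul_pos one_half_pos (Set.mem_Ioi.1 hz)
  have h1 := (hl.comp hhalf).div hl hl0
  have h2 := tendsto_nhds_unique h1 (tendsto_endpointTail_div h (v := 1 / 2) (by norm_num))
  rw [div_self hl0] at h2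
  have := Real.rpow_lt_one (x := 1 / 2) (by norm_num) (by norm_num) (neg_one_div_pos h)
  exact absurd h2 this.ne'

/-- The distance from the upper endpoint to the quantile of order `1 - c / n`. -/
noncomputable def quantileGap (μ : Measure ℝ) (c : ℝ) (n : ℕ) : ℝ :=
  upperEndpoint (cdf μ) - quantile (cdf μ) (1 - c / n)

theorem le_quantileGap_iff {c : ℝ} (hc : 0 < c) {n : ℕ} (hn : c < n) {w : ℝ} :
    w ≤ quantileGap μ c n ↔ n * endpointTail μ w ≤ c := by
  have hn0 : (0 : ℝ) < n := hc.trans hn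
  have h1 : c / n < 1 := (div_lt_one hn0).2 hn
  have h2 : 1 - c / n < 1 := by linarith [div_pos hc hn0]
  have hne := ((tendsto_cdf_atTop μ).eventually_const_le h2).exists
  rw [quantileGap, le_sub_comm, quantile_le_iff (by linarith) hne, endpointTail, mul_comm,
    ← le_div_iff₀ hn0]
  constructor <;> intro <;> linarith

theorem tendsto_quantileGap (h : InTypeIIIDomain (cdf μ) ξ) {c : ℝ} (hc : 0 < c) :
    Tendsto (quantileGap μ c) atTop (𝓝[>] 0) := by
  have hev : ∀ᶠ n : ℕ in atTop, c < n := tendsto_natCast_atTop_atTop.eventually_gt_atTop c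
  have hpos : ∀ᶠ n in atTop, 0 < quantileGap μ c n := by
    filter_upwards [hev] with n hn
    have hn0 : (0 : ℝ) < n := hc.trans hn
    obtain ⟨w, hw, hw0⟩ := (((tendsto_endpointTail_zero h).eventually_lt_const
      (div_pos hc hn0)).and self_mem_nhdsWithin).exists
    refine lt_of_lt_of_le hw0 ((le_quantileGap_iff hc hn).2 ?_)
    rw [mul_comm]
    exact ((lt_div_iff₀ hn0).1 hw).le
  refine tendsto_nhdsWithin_iff.2 ⟨tendsto_order.2 ⟨fun a ha => ?_, fun a ha => ?_⟩, hpos⟩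
  · filter_upwards [hpos] with n hn using ha.trans hn
  · filter_upwards [hev, (tendsto_natCast_atTop_atTop.atTop_mul_const
      (endpointTail_pos (μ := μ) ha)).eventually_gt_atTop c] with n hn hn2
    by_contra! h3
    exact ((le_quantileGap_iff hc hn).1 h3).not_gt hn2

/-- F may jump, so the tail at the quantile need not equal 1/n. It is at most 1/n by definition, and
enlarging the gap by any factor w > 1 pushes it above 1/n. Regular variation charges only w^(-1/ξ)
for this, which is close to 1 when w is. -/
theorem tendsto_mul_endpointTail_quantileGap_one (h : InTypeIIIDomain (cdf μ) ξ) :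
    Tendsto (fun n : ℕ => n * endpointTail μ (quantileGap μ 1 n)) atTop (𝓝 1) := by
  have hev : ∀ᶠ n : ℕ in atTop, (1 : ℝ) < n := tendsto_natCast_atTop_atTop.eventually_gt_atTop 1
  have hgap := tendsto_quantileGap h one_pos
  have hpos : ∀ᶠ n in atTop, 0 < quantileGap μ 1 n := hgap.eventually self_mem_nhdsWithin
  refine tendsto_order.2 ⟨fun a ha => ?_, fun a ha => ?_⟩
  · obtain ⟨w, hw, hw1⟩ : ∃ w : ℝ, a * w ^ (-1 / ξ) < 1 ∧ 1 < w := by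
      have : Tendsto (fun w : ℝ => a * w ^ (-1 / ξ)) (𝓝[>] 1) (𝓝 (a * 1 ^ (-1 / ξ))) :=
        ((Real.continuousAt_rpow_const 1 _ (Or.inl one_ne_zero)).tendsto.const_mul a).mono_left
          nhdsWithin_le_nhds
      rw [Real.one_rpow, mul_one] at this
      exact ((this.eventually_lt_const ha).and self_mem_nhdsWithin).exists
    have hr := ((tendsto_endpointTail_div h (one_pos.trans hw1)).comp hgap).const_mul a
    filter_upwards [hev, hpos, hr.eventually_lt_const hw] with n hn hn0 hlt
    have h1 : ¬ w * quantileGap μ 1 n ≤ quantileGap μ 1 n := by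
      rw [not_le]
      exact lt_mul_of_one_lt_left hn0 hw1
    rw [le_quantileGap_iff one_pos hn, not_le] at h1
    have h2 := endpointTail_pos (μ := μ) hn0
    simp only [Function.comp_apply] at hlt
    rw [← mul_div_assoc, div_lt_one h2] at hlt
    have h3 := endpointTail_pos (μ := μ) (mul_pos (one_pos.trans hw1) hn0)
    by_contra! h4
    -- With T the tail and g the gap, a T(wg) < T(g) and 1 < n T(wg) together contradict n T(g) ≤ a.
    have h5 : endpointTail μ (w * quantileGap μ 1 n) * (n * endpointTail μ (quantileGap μ 1 n)) ≤
      endpointTail μ (w * quantileGap μ 1 n) * a := mul_le_mul_of_nonneg_left h4 h3.le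
    nlinarith
  · filter_upwards [hev] with n hn
    exact ((le_quantileGap_iff one_pos hn).1 le_rfl).trans_lt ha

theorem tendsto_mul_endpointTail (h : InTypeIIIDomain (cdf μ) ξ) {v : ℝ} (hv : 0 < v) :
    Tendsto (fun n : ℕ => n * endpointTail μ (v * quantileGap μ 1 n)) atTop
      (𝓝 (v ^ (-1 / ξ))) := by
  have hgap := tendsto_quantileGap h one_pos
  have hpos : ∀ᶠ n in atTop, 0 < quantileGap μ 1 n := hgap.eventually self_mem_nhdsWithin
  have := (tendsto_mul_endpointTail_quantileGap_one h).mul ((tendsto_endpointTail_div h hv).comp hgap)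
  rw [one_mul] at this
  refine this.congr' ?_
  filter_upwards [hpos] with n hn
  have := endpointTail_pos (μ := μ) hn
  simp only [Function.comp_apply]
  field_simp

/-- For v ≤ 0 the threshold is at or above the endpoint, where the tail vanishes. -/
theorem tendsto_mul_endpointTail_max (h : InTypeIIIDomain (cdf μ) ξ) (v : ℝ) :
    Tendsto (fun n : ℕ => n * endpointTail μ (v * quantileGap μ 1 n)) atTop
      (𝓝 (max v 0 ^ (-1 / ξ))) := by
  rcases lt_or_ge 0 v with hv | hv
  · rw [max_eq_left hv.le]
    exact tendsto_mul_endpointTail h hv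
  · rw [max_eq_right hv, Real.zero_rpow (neg_one_div_pos h).ne']
    refine tendsto_const_nhds.congr' ?_
    filter_upwards [(tendsto_quantileGap h one_pos).eventually self_mem_nhdsWithin] with n hn
    rw [endpointTail_of_nonpos h.2.1 (mul_nonpos_of_nonpos_of_nonneg hv (le_of_lt hn)), mul_zero]

/-- Comparing the gap with v times the gap at c = 1 amounts to comparing n times a tail with c, and
that quantity tends to v^(-1/ξ). Since η(c) is where this power equals c, values of v on either side
of η(c) squeeze the ratio. -/
theorem tendsto_quantileGap_div (h : InTypeIIIDomain (cdf μ) ξ) {c : ℝ} (hc : 0 < c) :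
    Tendsto (fun n => quantileGap μ c n / quantileGap μ 1 n) atTop (𝓝 (eta ξ c)) := by
  have hev : ∀ᶠ n : ℕ in atTop, c < n := tendsto_natCast_atTop_atTop.eventually_gt_atTop c
  have hgap := tendsto_quantileGap h one_pos
  have hpos : ∀ᶠ n in atTop, 0 < quantileGap μ 1 n := hgap.eventually self_mem_nhdsWithin
  have hξ := neg_one_div_pos h
  have hη : 0 < eta ξ c := Real.rpow_pos_of_pos hc _
  have hηc : eta ξ c ^ (-1 / ξ) = c := by
    rw [eta, ← Real.rpow_mul hc.le]
    have := h.1.ne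
    field_simp
    simp
  refine tendsto_order.2 ⟨fun a ha => ?_, fun a ha => ?_⟩
  · obtain ⟨v, hav, hv⟩ := exists_between (max_lt ha hη)
    have hv0 : 0 < v := (le_max_right _ _).trans_lt hav
    have h1 : v ^ (-1 / ξ) < c := by
      rw [← hηc]
      exact Real.rpow_lt_rpow hv0.le hv hξ
    filter_upwards [hev, hpos, (tendsto_mul_endpointTail h hv0).eventually_lt_const h1]
      with n hn hn0 hlt
    refine ((le_max_left _ _).trans_lt hav).trans_le ?_
    rw [le_div_iff₀ hn0, le_quantileGap_iff hc hn]
    exact hlt.le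
  · have ha0 := hη.trans ha
    have h1 : c < a ^ (-1 / ξ) := by
      rw [← hηc]
      exact Real.rpow_lt_rpow hη.le ha hξ
    filter_upwards [hev, hpos, (tendsto_mul_endpointTail h ha0).eventually_const_lt h1]
      with n hn hn0 hlt
    rw [div_lt_iff₀ hn0, ← not_le, le_quantileGap_iff hc hn, not_le]
    exact hlt

end Quantile

/-! ### Sample quantiles as order statistics -/

/-- Convexity: the right derivative at the left endpoint bounds the increment from below. The next
lemma uses the left derivative at the right endpoint, hence the change from strict to weak
inequality in the indicator. -/
theorem le_checkFn_sub {τ y q q' : ℝ} (h : q ≤ q') :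
    (q' - q) * (1 - τ - if q < y then 1 else 0) ≤ checkFn τ (y - q') - checkFn τ (y - q) := by
  simp only [checkFn, Set.indicator_apply, Set.mem_Iic, Pi.one_apply, sub_nonpos]
  split_ifs <;> nlinarith

theorem checkFn_sub_le {τ y q q' : ℝ} (h : q ≤ q') :
    checkFn τ (y - q') - checkFn τ (y - q) ≤ (q' - q) * (1 - τ - if q' ≤ y then 1 else 0) := by
  simp only [checkFn, Set.indicator_apply, Set.mem_Iic, Pi.one_apply, sub_nonpos]
  split_ifs <;> nlinarith

open Classical in
/-- The number of observations with input at most `x`. -/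
noncomputable def dominatedCount {d : ℕ} (X : ℕ → Fin d → ℝ) (x : Fin d → ℝ) (n : ℕ) : ℕ :=
  ∑ i ∈ Finset.range n, if X i ≤ x then 1 else 0

open Classical in
/-- The number of observations with input at most `x` and output above `t`. -/
noncomputable def exceedanceCount {d : ℕ} (X : ℕ → Fin d → ℝ) (Y : ℕ → ℝ) (x : Fin d → ℝ)
    (n : ℕ) (t : ℝ) : ℕ :=
  ∑ i ∈ Finset.range n, if X i ≤ x ∧ t < Y i then 1 else 0

variable {d : ℕ} {X : ℕ → Fin d → ℝ} {Y : ℕ → ℝ} {x : Fin d → ℝ} {n : ℕ} {τ q : ℝ}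

theorem le_objective_sub {t q : ℝ} (h : t ≤ q) :
    (q - t) * ((1 - τ) * dominatedCount X x n - exceedanceCount X Y x n t) ≤
      objective X Y x n τ q - objective X Y x n τ t := by
  simp only [objective, dominatedCount, exceedanceCount, ← Finset.sum_sub_distrib, Nat.cast_sum,
    Finset.mul_sum]
  refine Finset.sum_le_sum fun i _ => ?_
  have := le_checkFn_sub (τ := τ) (y := Y i) h
  by_cases hx : X i ≤ x
  · simpa [hx] using this
  · simp [hx]

/-- No output lies strictly between t and t', so the left slope at t' can be expressed by the
exceedances of t. -/
theorem objective_sub_le {t t' q : ℝ} (h : q ≤ t') (htt : t < t')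
    (ht : ∀ i ∈ Finset.range n, t < Y i → t' ≤ Y i) :
    objective X Y x n τ t' - objective X Y x n τ q ≤
      (t' - q) * ((1 - τ) * dominatedCount X x n - exceedanceCount X Y x n t) := by
  simp only [objective, dominatedCount, exceedanceCount, ← Finset.sum_sub_distrib, Nat.cast_sum,
    Finset.mul_sum]
  refine Finset.sum_le_sum fun i hi => ?_
  have := checkFn_sub_le (τ := τ) (y := Y i) h
  have hiff : t' ≤ Y i ↔ t < Y i := ⟨fun h => htt.trans_le h, ht i hi⟩
  rw [if_congr hiff rfl rfl] at this
  by_cases hx : X i ≤ x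
  · simpa [hx] using this
  · simp [hx]

/-- If `(1 - τ) N` lies strictly between `m` and `m + 1`, where `N` is the number of observations
with input at most `x`, then the sample quantile is the `(m + 1)`-th largest output among them. -/
theorem IsSampleQuantile.le_iff (hq : IsSampleQuantile X Y x n τ q) {m : ℕ}
    (h1 : m < (1 - τ) * dominatedCount X x n) (h2 : (1 - τ) * dominatedCount X x n < m + 1)
    {t : ℝ} : q ≤ t ↔ exceedanceCount X Y x n t ≤ m := by
  constructor
  · intro hqt
    by_contra! hm
    -- The minimizer may equal t, so a point slightly to the right, below every output exceeding t,
    -- is needed for a strict decrease of the objective.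
    obtain ⟨t', ht', htt'⟩ : ∃ t', (∀ i ∈ Finset.range n, t < Y i → t' ≤ Y i) ∧ t < t' := by
      refine (Eventually.and (f := 𝓝[>] t) ?_ self_mem_nhdsWithin).exists
      rw [Filter.eventually_all_finset]
      intro i _
      rcases lt_or_ge t (Y i) with hi | hi
      · filter_upwards [Ioo_mem_nhdsGT hi] with t' ht' _ using ht'.2.le
      · exact Eventually.of_forall fun _ h => absurd h hi.not_gt
    have h3 := objective_sub_le (X := X) (x := x) (τ := τ) (hqt.trans htt'.le) htt' ht'
    have h4 : ((m + 1 : ℕ) : ℝ) ≤ exceedanceCount X Y x n t := Nat.cast_le.2 hm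
    push_cast at h4
    have h5 := mul_neg_of_pos_of_neg (sub_pos.2 (hqt.trans_lt htt'))
      (show (1 - τ) * dominatedCount X x n - exceedanceCount X Y x n t < 0 by linarith)
    linarith [hq t']
  · intro hm
    by_contra! hqt
    have h3 := le_objective_sub (X := X) (Y := Y) (x := x) (n := n) (τ := τ) hqt.le
    have h4 : (exceedanceCount X Y x n t : ℝ) ≤ m := Nat.cast_le.2 hm
    have h5 := mul_pos (sub_pos.2 hqt)
      (show 0 < (1 - τ) * dominatedCount X x n - exceedanceCount X Y x n t by linarith)
    linarith [hq t]

/-! ### Convergence in distribution from distribution functions -/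

theorem measureReal_map_Ioc {Ω : Type*} [MeasurableSpace Ω] {P : Measure Ω}
    [IsProbabilityMeasure P] {V : Ω → ℝ} (hV : AEMeasurable V P) {a b : ℝ} (hab : a ≤ b) :
    (P.map V).real (Set.Ioc a b) = P.real {ω | V ω ≤ b} - P.real {ω | V ω ≤ a} := by
  have e (s : ℝ) : P.real {ω | V ω ≤ s} = (P.map V).real (Set.Iic s) := by
    rw [map_measureReal_apply_of_aemeasurable hV measurableSet_Iic]
    rfl
  have := Measure.isProbabilityMeasure_map hV
  rw [e, e, ← measureReal_sdiff (Set.Iic_subset_Iic.2 hab) measurableSet_Iic]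
  congr 1
  ext z
  simp [and_comm]

/-- Pointwise convergence of distribution functions implies convergence in distribution. -/
theorem tendstoInDistribution_of_tendsto_cdf {Ω Ω' : Type*} [MeasurableSpace Ω]
    [MeasurableSpace Ω'] {P : Measure Ω} [IsProbabilityMeasure P] {P' : Measure Ω'}
    [IsProbabilityMeasure P'] {Z : ℕ → Ω → ℝ} {L : Ω' → ℝ} (hZ : ∀ n, AEMeasurable (Z n) P)
    (hL : AEMeasurable L P')
    (h : ∀ s, Tendsto (fun n => P.real {ω | Z n ω ≤ s}) atTop (𝓝 (P'.real {ω | L ω ≤ s}))) :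
    TendstoInDistribution Z atTop L (fun _ => P) P' := by
  refine ⟨hZ, hL, ?_⟩
  -- Half-open intervals form a π-system containing arbitrarily small neighbourhoods of each point,
  -- so convergence on them suffices.
  refine (isPiSystem_Ioc (id : ℝ → ℝ) id).tendsto_probabilityMeasure_of_tendsto_of_mem ?_ ?_ ?_
  · rintro _ ⟨a, b, -, rfl⟩
    exact measurableSet_Ioc
  · intro u hu y hy
    obtain ⟨ε, hε, hb⟩ := Metric.isOpen_iff.1 hu y hy
    refine ⟨Set.Ioc (y - ε / 2) (y + ε / 2), ⟨_, _, by simp only [id]; linarith, rfl⟩,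
      Ioc_mem_nhds (by linarith) (by linarith), fun z hz => hb ?_⟩
    rw [Metric.mem_ball, Real.dist_eq, abs_lt]
    constructor <;> linarith [hz.1, hz.2]
  · rintro _ ⟨a, b, hab, rfl⟩
    refine (NNReal.tendsto_coe (f := atTop)).1 ?_
    change Tendsto (fun n => (P.map (Z n)).real (Set.Ioc a b)) atTop
      (𝓝 ((P'.map L).real (Set.Ioc a b)))
    have hab' : a ≤ b := le_of_lt hab
    rw [measureReal_map_Ioc hL hab']
    exact ((h b).sub (h a)).congr fun n => (measureReal_map_Ioc (hZ n) hab').symm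

/-! ### Counts in an i.i.d. sample -/

section Sampling

variable {Ω : Type*} [MeasurableSpace Ω] {P : Measure Ω} [IsProbabilityMeasure P] {d : ℕ}

section SinglePair

variable {X : Ω → Fin d → ℝ} {Y : Ω → ℝ} {x : Fin d → ℝ}

theorem condCDF_eq_cdf (hY : Measurable Y) (hx : 0 < P.real {ω | X ω ≤ x}) :
    condCDF P X Y x = cdf ((P[|{ω | X ω ≤ x}]).map Y) := by
  have : IsProbabilityMeasure (P[|{ω | X ω ≤ x}]) :=
    cond_isProbabilityMeasure fun h => hx.ne' (by simp [measureReal_def, h])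
  have := Measure.isProbabilityMeasure_map (μ := P[|{ω | X ω ≤ x}]) hY.aemeasurable
  ext y
  rw [cdf_eq_real, map_measureReal_apply hY measurableSet_Iic]
  rfl

theorem measureReal_exceedance (hX : Measurable X) (hY : Measurable Y)
    (hx : 0 < P.real {ω | X ω ≤ x}) (t : ℝ) :
    P.real {ω | X ω ≤ x ∧ t < Y ω} = P.real {ω | X ω ≤ x} * (1 - condCDF P X Y x t) := by
  have : IsProbabilityMeasure (P[|{ω | X ω ≤ x}]) :=
    cond_isProbabilityMeasure fun h => hx.ne' (by simp [measureReal_def, h])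
  have hA : MeasurableSet {ω | X ω ≤ x} := measurableSet_le hX measurable_const
  rw [condCDF, ← probReal_compl_eq_one_sub (measurableSet_le hY measurable_const),
    measureReal_def (P[|_]), cond_apply hA, ENNReal.toReal_mul, ENNReal.toReal_inv,
    ← measureReal_def, ← measureReal_def, mul_inv_cancel_left₀ hx.ne']
  congr 1
  ext ω
  simp

end SinglePair

variable {X : ℕ → Ω → Fin d → ℝ} {Y : ℕ → Ω → ℝ} {x : Fin d → ℝ}

theorem measureReal_exceedanceCount_le (hX : ∀ i, Measurable (X i)) (hY : ∀ i, Measurable (Y i))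
    (hindep : iIndepFun (fun i ω => (X i ω, Y i ω)) P)
    (hident : ∀ i, IdentDistrib (fun ω => (X i ω, Y i ω)) (fun ω => (X 0 ω, Y 0 ω)) P P)
    (n m : ℕ) (t : ℝ) :
    P.real {ω | exceedanceCount (fun i => X i ω) (fun i => Y i ω) x n t ≤ m} =
      ∑ j ∈ Finset.range (m + 1), n.choose j * P.real {ω | X 0 ω ≤ x ∧ t < Y 0 ω} ^ j *
        (1 - P.real {ω | X 0 ω ≤ x ∧ t < Y 0 ω}) ^ (n - j) := by
  classical
  have hS : MeasurableSet {z : (Fin d → ℝ) × ℝ | z.1 ≤ x ∧ t < z.2} :=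
    (measurableSet_le measurable_fst measurable_const).inter
      (measurableSet_lt measurable_const measurable_snd)
  let W : ℕ → Ω → ℕ := fun i ω => if X i ω ≤ x ∧ t < Y i ω then 1 else 0
  have hW : ∀ i, Measurable (W i) := fun i =>
    Measurable.ite (((hX i).prodMk (hY i)) hS) measurable_const measurable_const
  have hWindep : iIndepFun W P :=
    hindep.comp (fun _ z => if z.1 ≤ x ∧ t < z.2 then 1 else 0)
      fun _ => Measurable.ite hS measurable_const measurable_const
  have hp : ∀ i, P.real {ω | W i ω = 1} = P.real {ω | X 0 ω ≤ x ∧ t < Y 0 ω} := by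
    intro i
    have h1 : {ω | W i ω = 1} = (fun ω => (X i ω, Y i ω)) ⁻¹' {z | z.1 ≤ x ∧ t < z.2} := by
      ext ω
      simp [W]
    rw [h1, measureReal_def, (hident i).measure_mem_eq hS]
    rfl
  have hle : ∀ i ω, W i ω ≤ 1 := fun i ω => by
    simp only [W]
    split_ifs <;> simp
  have hset : {ω | exceedanceCount (fun i => X i ω) (fun i => Y i ω) x n t ≤ m} =
      (fun ω => ∑ i ∈ Finset.range n, W i ω) ⁻¹' (Finset.range (m + 1) : Finset ℕ) := by
    ext ω
    simp only [exceedanceCount, W, Set.mem_ofPred_eq, Set.mem_preimage, Finset.coe_range,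
      Set.mem_Iio, Nat.lt_succ_iff]
  rw [hset, ← sum_measureReal_preimage_singleton]
  · exact Finset.sum_congr rfl fun j _ => measureReal_sum_bernoulli_eq hW hle hWindep hp n j
  · intro j _
    exact (Finset.measurable_fun_sum _ fun i _ => hW i) (measurableSet_singleton j)

theorem tendsto_dominatedCount_div (hX : ∀ i, Measurable (X i))
    (hindep : iIndepFun (fun i ω => (X i ω, Y i ω)) P)
    (hident : ∀ i, IdentDistrib (fun ω => (X i ω, Y i ω)) (fun ω => (X 0 ω, Y 0 ω)) P P) :
    ∀ᵐ ω ∂P, Tendsto (fun n : ℕ => (dominatedCount (fun i => X i ω) x n : ℝ) / n) atTop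
      (𝓝 (P.real {ω | X 0 ω ≤ x})) := by
  classical
  have hS : MeasurableSet {z : (Fin d → ℝ) × ℝ | z.1 ≤ x} :=
    measurableSet_le measurable_fst measurable_const
  let f : (Fin d → ℝ) × ℝ → ℝ := Set.indicator {z | z.1 ≤ x} 1
  have hf : Measurable f := measurable_one.indicator hS
  have hA : MeasurableSet {ω | X 0 ω ≤ x} := measurableSet_le (hX 0) measurable_const
  have heq : (fun ω => f (X 0 ω, Y 0 ω)) = Set.indicator {ω | X 0 ω ≤ x} 1 := rfl
  have hint : Integrable (fun ω => f (X 0 ω, Y 0 ω)) P := by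
    rw [heq]
    exact (integrable_const (1 : ℝ)).indicator hA
  have := strong_law_ae_real (fun i ω => f (X i ω, Y i ω)) hint
    (fun i j hij => (hindep.indepFun hij).comp hf hf) (fun i => (hident i).comp hf)
  rw [heq, integral_indicator_one hA] at this
  filter_upwards [this] with ω hω
  refine hω.congr fun n => ?_
  simp [dominatedCount, f, Set.indicator_apply]

theorem measurable_dominatedCount (hX : ∀ i, Measurable (X i)) (n : ℕ) :
    Measurable fun ω => dominatedCount (fun i => X i ω) x n :=
  Finset.measurable_fun_sum _ fun i _ => Measurable.ite
    (measurableSet_le (hX i) measurable_const) measurable_const measurable_const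

/-- The strong law gives almost sure convergence of kN/n to an interior point of (a, b), and
convergence in measure follows. -/
theorem tendsto_measureReal_dominatedCount_notMem (hX : ∀ i, Measurable (X i))
    (hindep : iIndepFun (fun i ω => (X i ω, Y i ω)) P)
    (hident : ∀ i, IdentDistrib (fun ω => (X i ω, Y i ω)) (fun ω => (X 0 ω, Y 0 ω)) P P)
    {k a b : ℝ} (ha : a < k * P.real {ω | X 0 ω ≤ x}) (hb : k * P.real {ω | X 0 ω ≤ x} < b) :
    Tendsto (fun n : ℕ => P.real {ω |
      (1 - (1 - k / n)) * dominatedCount (fun i => X i ω) x n ∉ Set.Ioo a b}) atTop (𝓝 0) := by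
  set p₀ := P.real {ω | X 0 ω ≤ x}
  have hae : ∀ᵐ ω ∂P, Tendsto (fun n : ℕ =>
      (1 - (1 - k / n)) * (dominatedCount (fun i => X i ω) x n : ℝ)) atTop (𝓝 (k * p₀)) := by
    filter_upwards [tendsto_dominatedCount_div (x := x) hX hindep hident] with ω hω
    refine (hω.const_mul k).congr fun n => ?_
    ring
  have hmeas := tendstoInMeasure_of_tendsto_ae (μ := P) (fun n =>
    (((measurable_from_top.comp (measurable_dominatedCount (x := x) hX n)).const_mul
      (1 - (1 - k / n))).aestronglyMeasurable)) hae
  have hε : 0 < min (k * p₀ - a) (b - k * p₀) := lt_min (sub_pos.2 ha) (sub_pos.2 hb)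
  have h0 := (ENNReal.tendsto_toReal ENNReal.zero_ne_top).comp
    (tendstoInMeasure_iff_dist.1 hmeas _ hε)
  refine squeeze_zero (fun _ => measureReal_nonneg) (fun n => ?_) h0
  refine measureReal_mono fun ω hω => ?_
  simp only [Set.mem_ofPred_eq, Function.comp_apply] at hω ⊢
  by_contra! h
  refine hω ?_
  rw [Real.dist_eq, abs_lt] at h
  constructor <;> linarith [h.1, h.2, min_le_left (k * p₀ - a) (b - k * p₀),
    min_le_right (k * p₀ - a) (b - k * p₀)]

end Sampling

/-! ### Distribution of the limit variable -/

section Limit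

variable {Ω' : Type*} [MeasurableSpace Ω'] {P' : Measure Ω'}
  {E : ℕ → Ω' → ℝ} {p₀ ξ : ℝ}

theorem aemeasurable_limitVar (hlaw : ∀ l, HasLaw (E l) (expMeasure 1) P') (h : ℕ) :
    AEMeasurable (limitVar E p₀ ξ h) P' := by
  unfold limitVar eta
  exact ((Finset.aemeasurable_fun_sum _ fun l _ => (hlaw l).aemeasurable).div_const _).pow_const _

theorem measureReal_neg_limitVar_le [IsProbabilityMeasure P'] (hindep : iIndepFun E P')
    (hlaw : ∀ l, HasLaw (E l) (expMeasure 1) P') (hp₀ : 0 < p₀) (hξ : ξ < 0) (m : ℕ) (s : ℝ) :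
    P'.real {ω | -limitVar E p₀ ξ (m + 1) ω ≤ s} =
      poissonCDF m (p₀ * max (-s) 0 ^ (-1 / ξ)) := by
  have hr : 0 ≤ p₀ * max (-s) 0 ^ (-1 / ξ) := by positivity
  -- Inverting the power needs a nonnegative sum, which holds only almost surely; the truncation of
  -- -s at 0 covers s ≥ 0, where both events have full measure.
  have hset : {ω | -limitVar E p₀ ξ (m + 1) ω ≤ s} =ᵐ[P']
      {ω | p₀ * max (-s) 0 ^ (-1 / ξ) ≤ ∑ l ∈ Finset.range (m + 1), E l ω} := by
    refine eventuallyEq_set.2 ?_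
    filter_upwards [ae_nonneg_of_hasLaw_exponential hlaw] with ω hω
    have hS : 0 ≤ (∑ l ∈ Finset.range (m + 1), E l ω) / p₀ :=
      div_nonneg (Finset.sum_nonneg fun l _ => hω l) hp₀.le
    have hexp : -1 / ξ = (-ξ)⁻¹ := by rw [inv_neg, neg_div, one_div]
    simp only [limitVar, eta]
    rw [neg_le, mul_comm, ← le_div_iff₀ hp₀, hexp,
      Real.rpow_inv_le_iff_of_pos (le_max_right _ _) hS (neg_pos.2 hξ), max_le_iff]
    exact ⟨fun h => ⟨h, Real.rpow_nonneg hS _⟩, fun h => h.1⟩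
  rw [measureReal_congr hset, measureReal_def, measure_le_sum_exponential hindep hlaw,
    max_eq_left hr, ENNReal.toReal_ofReal (poissonCDF_nonneg m hr)]

end Limit

/-! ### Limit law of the normalized sample quantile -/

section Asymptotics

variable {Ω : Type*} [MeasurableSpace Ω] {P : Measure Ω} [IsProbabilityMeasure P] {d : ℕ}
  {X : ℕ → Ω → Fin d → ℝ} {Y : ℕ → Ω → ℝ} {x : Fin d → ℝ} {k ξ : ℝ} {m : ℕ} {qhat : ℕ → Ω → ℝ}

theorem normRate_eq {μ : Measure ℝ} (hb : BddAbove {z | cdf μ z < 1}) (n : ℕ) :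
    normRate (cdf μ) n = 1 / quantileGap μ 1 n := by
  rw [normRate, quantileGap, quantile_one_eq_upperEndpoint hb]

theorem tendsto_measureReal_exceedanceCount_le (hX : ∀ i, Measurable (X i))
    (hY : ∀ i, Measurable (Y i)) (hindep : iIndepFun (fun i ω => (X i ω, Y i ω)) P)
    (hident : ∀ i, IdentDistrib (fun ω => (X i ω, Y i ω)) (fun ω => (X 0 ω, Y 0 ω)) P P)
    (hx : 0 < P.real {ω | X 0 ω ≤ x}) {μ : Measure ℝ} (hμ : condCDF P (X 0) (Y 0) x = cdf μ)
    (hEV : InTypeIIIDomain (cdf μ) ξ) (m : ℕ) (s : ℝ) :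
    Tendsto (fun n => P.real {ω | exceedanceCount (fun i => X i ω) (fun i => Y i ω) x n
        (upperEndpoint (cdf μ) + s * quantileGap μ 1 n) ≤ m}) atTop
      (𝓝 (poissonCDF m (P.real {ω | X 0 ω ≤ x} * max (-s) 0 ^ (-1 / ξ)))) := by
  simp_rw [measureReal_exceedanceCount_le hX hY hindep hident,
    measureReal_exceedance (hX 0) (hY 0) hx, hμ]
  refine tendsto_finsetSum _ fun j _ => tendsto_choose_mul_pow_of_tendsto_mul_atTop j ?_
  refine ((tendsto_mul_endpointTail_max hEV (-s)).const_mul _).congr fun n => ?_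
  rw [endpointTail, neg_mul, sub_neg_eq_add]
  ring

theorem tendsto_measureReal_sampleQuantile_le (hX : ∀ i, Measurable (X i))
    (hY : ∀ i, Measurable (Y i)) (hindep : iIndepFun (fun i ω => (X i ω, Y i ω)) P)
    (hident : ∀ i, IdentDistrib (fun ω => (X i ω, Y i ω)) (fun ω => (X 0 ω, Y 0 ω)) P P)
    (hx : 0 < P.real {ω | X 0 ω ≤ x}) {μ : Measure ℝ} (hμ : condCDF P (X 0) (Y 0) x = cdf μ)
    (hEV : InTypeIIIDomain (cdf μ) ξ) (hm : m < k * P.real {ω | X 0 ω ≤ x})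
    (hm' : k * P.real {ω | X 0 ω ≤ x} < m + 1)
    (hqhat : ∀ n : ℕ, k < n → ∀ᵐ ω ∂P,
      IsSampleQuantile (fun i => X i ω) (fun i => Y i ω) x n (1 - k / n) (qhat n ω)) (s : ℝ) :
    Tendsto (fun n => P.real {ω | normRate (cdf μ) n * (qhat n ω - quantile (cdf μ) 1) ≤ s}) atTop
      (𝓝 (poissonCDF m (P.real {ω | X 0 ω ≤ x} * max (-s) 0 ^ (-1 / ξ)))) := by
  have h1 := tendsto_measureReal_exceedanceCount_le hX hY hindep hident hx hμ hEV m s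
  have h2 := tendsto_measureReal_dominatedCount_notMem hX hindep hident hm hm'
  -- The quantile event and the count event agree off the event that kN/n leaves (m, m + 1), so
  -- their probabilities differ by at most its probability.
  refine tendsto_of_tendsto_of_dist h1 ?_
  refine squeeze_zero' (Eventually.of_forall fun _ => dist_nonneg) ?_ h2
  filter_upwards [tendsto_natCast_atTop_atTop.eventually_gt_atTop k,
    (tendsto_quantileGap hEV one_pos).eventually self_mem_nhdsWithin] with n hn hgap
  have hgap : 0 < quantileGap μ 1 n := hgap
  have hiff : ∀ᵐ ω ∂P, (1 - (1 - k / n)) * dominatedCount (fun i => X i ω) x n ∈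
        Set.Ioo (m : ℝ) (m + 1) →
      (exceedanceCount (fun i => X i ω) (fun i => Y i ω) x n
        (upperEndpoint (cdf μ) + s * quantileGap μ 1 n) ≤ m ↔
      normRate (cdf μ) n * (qhat n ω - quantile (cdf μ) 1) ≤ s) := by
    filter_upwards [hqhat n hn] with ω hω hgood
    rw [← hω.le_iff hgood.1 hgood.2, normRate_eq hEV.2.1, quantile_one_eq_upperEndpoint hEV.2.1,
      one_div_mul_eq_div, div_le_iff₀ hgap, sub_le_iff_le_add']
  have hle {A B C : Set Ω} (h : ∀ᵐ ω ∂P, ω ∈ A → ω ∉ C → ω ∈ B) :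
      P.real A ≤ P.real B + P.real C := by
    refine le_trans (ENNReal.toReal_mono (by finiteness) (measure_mono_ae (t := B ∪ C) ?_))
      (measureReal_union_le B C)
    filter_upwards [h] with ω hω hA
    by_cases hC : ω ∈ C
    · exact Or.inr hC
    · exact Or.inl (hω hA hC)
  rw [Real.dist_eq, abs_le]
  constructor
  · rw [neg_le_sub_iff_le_add]
    refine hle ?_
    filter_upwards [hiff] with ω hω h h'
    exact (hω (not_not.1 h')).2 h
  · rw [sub_le_iff_le_add']
    refine hle ?_
    filter_upwards [hiff] with ω hω h h'
    exact (hω (not_not.1 h')).1 h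

end Asymptotics

end Frontier

theorem mainTheorem1
    {Ω : Type*} [MeasurableSpace Ω] (P : Measure Ω) [IsProbabilityMeasure P]
    {d : ℕ} (T : Set ((Fin d → ℝ) × ℝ))
    (hT : Frontier.IsTechnology T) (hFD : Frontier.FreeDisposability T)
    (X : ℕ → Ω → Fin d → ℝ) (Y : ℕ → Ω → ℝ)
    (hX : ∀ i, Measurable (X i)) (hY : ∀ i, Measurable (Y i))
    (hXY : ∀ i, ∀ᵐ ω ∂P, (X i ω, Y i ω) ∈ T)
    (hindep : iIndepFun (fun i ω => (X i ω, Y i ω)) P)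
    (hident : ∀ i, IdentDistrib (fun ω => (X i ω, Y i ω)) (fun ω => (X 0 ω, Y 0 ω)) P P)
    (x : Fin d → ℝ) (p₀ : ℝ) (hp₀ : p₀ = P.real {ω | X 0 ω ≤ x}) (hp₀_pos : 0 < p₀)
    (k : ℝ) (hk : 0 < k) (hkp₀ : ∀ m : ℤ, k * p₀ ≠ m)
    (F : ℝ → ℝ) (hF : F = Frontier.condCDF P (X 0) (Y 0) x)
    (ξ₀ : ℝ) (hEV : Frontier.InTypeIIIDomain F ξ₀)
    (qhat : ℕ → Ω → ℝ) (hqhat_meas : ∀ n, AEMeasurable (qhat n) P)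
    (hqhat : ∀ n : ℕ, k < n → ∀ᵐ ω ∂P,
      Frontier.IsSampleQuantile (fun i => X i ω) (fun i => Y i ω) x n (1 - k / n) (qhat n ω))
    {Ω' : Type*} [MeasurableSpace Ω'] (P' : Measure Ω') [IsProbabilityMeasure P']
    (E : ℕ → Ω' → ℝ) (hE_indep : iIndepFun E P') (hE_law : ∀ l, HasLaw (E l) (expMeasure 1) P') :
    ∃ h : ℕ, (∀ m : ℤ, (m : ℝ) ∈ Set.Icc (k * p₀) (k * p₀ + 1) ↔ m = h) ∧
      TendstoInDistribution
        (fun (n : ℕ) ω => Frontier.normRate F n * (qhat n ω - Frontier.quantile F 1))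
        atTop (fun ω => -Frontier.limitVar E p₀ ξ₀ h ω) (fun _ => P) P' ∧
      TendstoInDistribution
        (fun (n : ℕ) ω => Frontier.normRate F n * (qhat n ω - Frontier.quantile F (1 - k / n)))
        atTop (fun ω => -Frontier.limitVar E p₀ ξ₀ h ω + Frontier.eta ξ₀ k) (fun _ => P) P' := by
  have hμ := Frontier.condCDF_eq_cdf (X := X 0) (x := x) (hY 0) (hp₀ ▸ hp₀_pos)
  set μ : Measure ℝ := (P[|{ω | X 0 ω ≤ x}]).map (Y 0)
  have hFμ : F = cdf μ := hF.trans hμ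
  subst hFμ
  -- The lower inequality for the floor is strict because k p₀ is not an integer.
  obtain ⟨m, hm, hm'⟩ : ∃ m : ℕ, (m : ℝ) < k * p₀ ∧ k * p₀ < m + 1 :=
    ⟨⌊k * p₀⌋₊, lt_of_le_of_ne (Nat.floor_le (by positivity))
      fun h => hkp₀ ⌊k * p₀⌋₊ (by rw [← h]; simp), Nat.lt_floor_add_one _⟩
  have hfirst : TendstoInDistribution
      (fun (n : ℕ) ω => Frontier.normRate (cdf μ) n * (qhat n ω - Frontier.quantile (cdf μ) 1))
      atTop (fun ω => -Frontier.limitVar E p₀ ξ₀ (m + 1) ω) (fun _ => P) P' := by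
    refine Frontier.tendstoInDistribution_of_tendsto_cdf
      (fun n => ((hqhat_meas n).sub_const _).const_mul _)
      (Frontier.aemeasurable_limitVar hE_law _).neg fun s => ?_
    rw [Frontier.measureReal_neg_limitVar_le hE_indep hE_law hp₀_pos hEV.1]
    subst hp₀
    exact Frontier.tendsto_measureReal_sampleQuantile_le hX hY hindep hident hp₀_pos hμ hEV hm hm'
      hqhat s
  refine ⟨m + 1, fun z => ⟨fun hz => ?_, ?_⟩, hfirst, ?_⟩
  · have h1 : (m : ℤ) < z := by exact_mod_cast hm.trans_le hz.1
    have h2 : z < (m : ℤ) + 2 := by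
      have : (z : ℝ) < m + 2 := by linarith [hz.2]
      exact_mod_cast this
    push_cast
    omega
  · rintro rfl
    push_cast
    exact ⟨hm'.le, by linarith⟩
  · have hgap := Frontier.tendsto_quantileGap_div hEV hk
    -- The ratio of gaps is α_n(q(1) - q(τ_n)), the difference between the two centrings.
    have hconst : TendstoInMeasure P
        (fun n (_ : Ω) => Frontier.quantileGap μ k n / Frontier.quantileGap μ 1 n) atTop
        (fun _ => Frontier.eta ξ₀ k) :=
      tendstoInMeasure_of_tendsto_ae (fun _ => aestronglyMeasurable_const)
        (Eventually.of_forall fun _ => hgap)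
    refine (hfirst.add_of_tendstoInMeasure_const hconst fun _ => aemeasurable_const).congr
      (fun n => Eventually.of_forall fun ω => ?_) EventuallyEq.rfl
    simp only [Pi.add_apply, Frontier.normRate_eq hEV.2.1, Frontier.quantileGap,
      Frontier.quantile_one_eq_upperEndpoint hEV.2.1]
    ring
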